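/- Let $n \ge 1$ and let $\Omega_n = \{z \in \mathbb{C}^n : |z_1| + |z_2|^2 + |z_3|^2 + \dots + |z_n|^2 < 1\}$, which is a convex domain (open and convex). The Bergman kernel function of $\Omega_n$, that is, the reproducing kernel $K(z,w)$ of the space of square-integrable holomorphic functions on $\Omega_n$ (so that $\overline{K(z,\cdot)}$ is holomorphic and square-integrable on $\Omega_n$ for each $z \in \Omega_n$, and $f(z) = \int_{\Omega_n} f(w) K(z,w)\, dV_w$ for every square-integrable holomorphic function $f$ on $\Omega_n$ and every $z \in \Omega_n$, where $dV$ is Lebesgue measure), exists, and it has zeroes in $\Omega_n \times \Omega_n$ (that is, $K(z,w) = 0$ for some $z, w \in \Omega_n$) if and only if $n \ge 4$. -/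

import Mathlib

open MeasureTheory
open scoped ComplexConjugate

/-- `f` is a square-integrable holomorphic function on `Ω ⊆ ℂⁿ`, that is, `f ∈ A²(Ω)`
(the measure is Lebesgue measure on `ℂⁿ = Fin n → ℂ`). -/
structure MemBergman {n : ℕ} (Ω : Set (Fin n → ℂ)) (f : (Fin n → ℂ) → ℂ) : Prop where
  holo : DifferentiableOn ℂ f Ω
  memLp : MemLp f 2 (volume.restrict Ω)

/-- `K` is the Bergman kernel function of the open set `Ω ⊆ ℂⁿ`: the reproducing kernel of the
Hilbert space of square-integrable holomorphic functions on `Ω`. For each `z ∈ Ω` the function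
`w ↦ conj (K z w)` lies in `A²(Ω)`, and `f z = ∫_Ω f(w) K(z, w) dV_w` for all `f ∈ A²(Ω)`.
These two properties determine `K` uniquely on `Ω × Ω` (and imply that `K w z = conj (K z w)`
there); the values of `K` off `Ω × Ω` are irrelevant. -/
structure IsBergmanKernel {n : ℕ} (Ω : Set (Fin n → ℂ))
    (K : (Fin n → ℂ) → (Fin n → ℂ) → ℂ) : Prop where
  mem : ∀ z ∈ Ω, MemBergman Ω (fun w => conj (K z w))
  reproducing : ∀ f, MemBergman Ω f → ∀ z ∈ Ω, f z = ∫ w in Ω, f w * K z w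

/-- The domain `{ |z₁| + |z₂|² + … + |zₙ|² < 1 }` in `ℂⁿ`, `n ≥ 1`; the coordinate `z₁` has
index `0 : Fin n`. -/
def foldedBall (n : ℕ) [NeZero n] : Set (Fin n → ℂ) :=
  {z | ‖z 0‖ + ∑ i ∈ Finset.univ.erase 0, ‖z i‖ ^ 2 < 1}

/-! Write `n = m + 1`. The domain fibres over the unit ball of `ℂᵐ`, the fibre over `x` being the
disc of radius `1 - |x|²`. Expanding `f` in powers of the first variable and integrating over the
fibres turns the reproducing identity into one identity per power `a`, on the ball with weight `(1 -
|x|²)^(2(a+1))`. The weighted ball kernels `(1 - ⟨z,w⟩)^-(m+1+s)` are known up to constants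
(`ballReproducing`); the same fibration, with radius `√(1 - |x|²)`, proves them by induction on
dimension. `BallReproducing.setIntegral_hartogsSet` performs both reductions.

Put `u = z₁ w̄₁ / (1 - ⟨z',w'⟩)²`, where a prime means dropping the first coordinate. Summing over
`a` gives the kernel as a nonvanishing factor times `∑ C(2a+m+2, m+1) uᵃ = O(u) / (1 - u)^(m+2)`,
where `O(s²) = ((1+s)^(m+2) - (1-s)^(m+2)) / (2s)`. On the domain `|u| < 1` (`norm_div_sq_le`), so
everything depends on whether the polynomial `O` vanishes in the unit disc. It does at
`-tan²(π/(m+2))` once `m + 2 > 4`; for `m + 2 = 2, 3, 4` it equals `2`, `3 + u`, `4(1 + u)`, with no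
zero there. Uniqueness of the Bergman kernel (`IsBergmanKernel.eq_of_mem`) carries this over to
every `K`. -/

/-! ### Taylor coefficients as weighted moments on discs -/

open scoped Nat in
/-- The `a`-th Taylor coefficient of `g` at the origin. -/
noncomputable def taylorCoeff (a : ℕ) (g : ℂ → ℂ) : ℂ := (a ! : ℂ)⁻¹ * iteratedDeriv a g 0

/-- The constant `a! s! / (a + s + 1)!`, a value of Euler's beta function. -/
noncomputable def betaConst (a s : ℕ) : ℝ :=
  (a.factorial * s.factorial : ℝ) / (a + s + 1).factorial

theorem betaConst_succ (a s : ℕ) :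
    betaConst a (s + 1) = (s + 1) / (a + 1) * betaConst (a + 1) s := by
  unfold betaConst
  rw [show a + 1 + s + 1 = a + (s + 1) + 1 by ring, Nat.factorial_succ s, Nat.factorial_succ a]
  have := Nat.factorial_ne_zero (a + (s + 1) + 1)
  push_cast
  field_simp

/-- Induction on `s`: the function `r^(2a+2) (R² - r²)^(s+1)` vanishes at both ends, so integrating
its derivative trades `(a, s+1)` for `(a+1, s)`. -/
theorem integral_pow_mul_sq_sub_sq_pow (a s : ℕ) (R : ℝ) :
    ∫ r in (0 : ℝ)..R, r ^ (2 * a + 1) * (R ^ 2 - r ^ 2) ^ s =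
      betaConst a s * R ^ (2 * (a + s + 1)) / 2 := by
  induction s generalizing a with
  | zero =>
    have : (a.factorial : ℝ) ≠ 0 := by positivity
    simp [betaConst, integral_pow, Nat.factorial_succ]
    field_simp
    ring
  | succ s ih =>
    have h1 : ∀ r ∈ Set.uIcc 0 R, HasDerivAt
        (fun r : ℝ => r ^ (2 * a + 2) * (R ^ 2 - r ^ 2) ^ (s + 1))
        ((2 * a + 2) * (r ^ (2 * a + 1) * (R ^ 2 - r ^ 2) ^ (s + 1)) -
          2 * (s + 1) * (r ^ (2 * (a + 1) + 1) * (R ^ 2 - r ^ 2) ^ s)) r := by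
      intro r _
      have := (hasDerivAt_pow (2 * a + 2) r).mul
        (((hasDerivAt_pow 2 r).const_sub (R ^ 2)).pow (s + 1))
      convert! this using 1
      simp
      ring
    have h2 := intervalIntegral.integral_eq_sub_of_hasDerivAt h1
      (Continuous.intervalIntegrable (by fun_prop) _ _)
    rw [intervalIntegral.integral_sub (Continuous.intervalIntegrable (by fun_prop) _ _)
      (Continuous.intervalIntegrable (by fun_prop) _ _), intervalIntegral.integral_const_mul,
      intervalIntegral.integral_const_mul, ih (a + 1)] at h2
    simp at h2
    rw [betaConst_succ, show a + (s + 1) + 1 = a + 1 + s + 1 by ring]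
    have : (a + 1 : ℝ) ≠ 0 := by positivity
    field_simp
    linarith

theorem circleIntegral_eq_taylorCoeff {g : ℂ → ℂ} {R r : ℝ} (hr : 0 < r) (hrR : r < R)
    (hg : DifferentiableOn ℂ g (Metric.ball 0 R)) (a : ℕ) :
    (∮ z in C(0, r), (1 / (z - 0) ^ (a + 1)) • g z) =
      2 * Real.pi * Complex.I * taylorCoeff a g := by
  rw [DifferentiableOn.circleIntegral_one_div_sub_center_pow_smul hr a
    (hg.mono (Metric.closedBall_subset_ball hrR))]
  simp [taylorCoeff]
  ring

/-- On the circle `w̄ = r²/w`, so this is Cauchy's integral for the `a`-th coefficient. -/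
theorem integral_mul_conj_pow_circle {g : ℂ → ℂ} {R r : ℝ} (hr : 0 < r) (hrR : r < R)
    (hg : DifferentiableOn ℂ g (Metric.ball 0 R)) (a : ℕ) :
    ∫ θ in Set.Ioo (-Real.pi) Real.pi, g (circleMap 0 r θ) * conj (circleMap 0 r θ) ^ a =
      2 * Real.pi * r ^ (2 * a) * taylorCoeff a g := by
  have h := circleIntegral_eq_taylorCoeff hr hrR hg a
  have key : ∀ θ : ℝ, g (circleMap 0 r θ) * conj (circleMap 0 r θ) ^ a =
      -Complex.I * r ^ (2 * a) * (deriv (circleMap 0 r) θ •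
        ((1 / (circleMap 0 r θ - 0) ^ (a + 1)) • g (circleMap 0 r θ))) := by
    intro θ
    have h0 : circleMap 0 r θ ≠ 0 := circleMap_ne_center hr.ne'
    have h1 : conj (circleMap 0 r θ) = r ^ 2 / circleMap 0 r θ := by
      rw [eq_div_iff h0, mul_comm, Complex.mul_conj, Complex.normSq_eq_norm_sq]
      simp [norm_circleMap_zero]
    rw [h1, deriv_circleMap]
    simp only [smul_eq_mul, sub_zero, div_pow, ← pow_mul]
    field_simp
    rw [Complex.I_sq]
    ring
  rw [← integral_Ioc_eq_integral_Ioo, ← intervalIntegral.integral_of_le (by linarith [Real.pi_pos])]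
  -- Polar coordinates use angles in `(-π, π)`, circle integrals use `(0, 2π)`; periodicity
  -- reconciles them.
  have hper : Function.Periodic
      (fun θ => g (circleMap 0 r θ) * conj (circleMap 0 r θ) ^ a) (2 * Real.pi) := by
    intro θ
    simp only [periodic_circleMap 0 r θ]
  have h2 := hper.intervalIntegral_add_eq (-Real.pi) 0
  rw [show -Real.pi + 2 * Real.pi = Real.pi by ring, zero_add] at h2
  rw [h2]
  simp_rw [key]
  rw [intervalIntegral.integral_const_mul]
  unfold circleIntegral at h
  rw [h]
  ring_nf
  rw [Complex.I_sq]
  ring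

theorem integrableOn_polarCoord_target {h : ℂ → ℂ} (hm : Measurable h) (hi : Integrable h) :
    IntegrableOn (fun p : ℝ × ℝ => p.1 • h (Complex.polarCoord.symm p)) polarCoord.target := by
  have hc : Measurable fun p : ℝ × ℝ => Complex.polarCoord.symm p := by
    simp only [Complex.polarCoord_symm_apply]
    fun_prop
  refine ⟨(measurable_fst.smul (hm.comp hc)).aestronglyMeasurable, ?_⟩
  have h1 := hi.2
  unfold HasFiniteIntegral at h1 ⊢
  rw [← Complex.lintegral_comp_polarCoord_symm] at h1
  refine lt_of_le_of_lt (le_of_eq ?_) h1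
  refine setLIntegral_congr_fun polarCoord.open_target.measurableSet (fun p hp => ?_)
  have : 0 < p.1 := hp.1
  simp only [enorm_smul, smul_eq_mul]
  rw [Real.enorm_of_nonneg this.le]

/-- The weight is radial: in polar coordinates the angular integral extracts the Taylor coefficient
and the radial one is the beta integral. -/
theorem integral_ball_mul_conj_pow {g : ℂ → ℂ} {R : ℝ} (hR : 0 < R)
    (hg : DifferentiableOn ℂ g (Metric.ball 0 R)) (a s : ℕ)
    (hi : IntegrableOn (fun w : ℂ => g w * ((R ^ 2 - ‖w‖ ^ 2) ^ s : ℝ) * conj w ^ a)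
      (Metric.ball 0 R)) :
    ∫ w in Metric.ball 0 R, g w * ((R ^ 2 - ‖w‖ ^ 2) ^ s : ℝ) * conj w ^ a =
      Real.pi * betaConst a s * R ^ (2 * (a + s + 1)) * taylorCoeff a g := by
  set F : ℂ → ℂ := fun w => g w * ((R ^ 2 - ‖w‖ ^ 2) ^ s : ℝ) * conj w ^ a with hF
  set h : ℂ → ℂ := (Metric.ball 0 R).indicator F with hh
  have hFc : ContinuousOn F (Metric.ball 0 R) :=
    (hg.continuousOn.mul (by fun_prop)).mul (by fun_prop)
  have hm : Measurable h := by
    classical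
    rw [hh, ← Set.piecewise_eq_indicator]
    exact hFc.measurable_piecewise continuousOn_const Metric.isOpen_ball.measurableSet
  have hi' : Integrable h := (integrable_indicator_iff Metric.isOpen_ball.measurableSet).2 hi
  have hpi := integrableOn_polarCoord_target hm hi'
  rw [← integral_indicator Metric.isOpen_ball.measurableSet, ← hh,
    ← Complex.integral_comp_polarCoord_symm]
  change IntegrableOn _ (Set.Ioi (0 : ℝ) ×ˢ Set.Ioo (-Real.pi) Real.pi) _ at hpi
  change ∫ p in (Set.Ioi (0 : ℝ) ×ˢ Set.Ioo (-Real.pi) Real.pi), _ = _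
  rw [Measure.volume_eq_prod] at hpi ⊢
  rw [setIntegral_prod _ hpi]
  have key : ∀ r ∈ Set.Ioi (0 : ℝ), (∫ θ in Set.Ioo (-Real.pi) Real.pi,
      r • h (Complex.polarCoord.symm (r, θ))) = (Set.Iio R).indicator (fun r : ℝ =>
        ((r ^ (2 * a + 1) * (R ^ 2 - r ^ 2) ^ s : ℝ) : ℂ) *
          (2 * Real.pi * taylorCoeff a g)) r := by
    intro r hr
    have hr : 0 < r := hr
    have hpc : ∀ θ : ℝ, Complex.polarCoord.symm (r, θ) = circleMap 0 r θ := by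
      intro θ
      simp [circleMap, Complex.exp_mul_I]
    simp_rw [hpc]
    by_cases hrR : r < R
    · rw [Set.indicator_of_mem (by exact hrR)]
      have : ∀ θ : ℝ, r • h (circleMap 0 r θ) = (r * (R ^ 2 - r ^ 2) ^ s : ℝ) *
          (g (circleMap 0 r θ) * conj (circleMap 0 r θ) ^ a) := by
        intro θ
        have hmem : circleMap 0 r θ ∈ Metric.ball (0 : ℂ) R := by
          simp [abs_of_pos hr, hrR]
        rw [hh, Set.indicator_of_mem hmem, hF]
        simp [norm_circleMap_zero]
        ring
      simp_rw [this]
      rw [integral_const_mul, integral_mul_conj_pow_circle hr hrR hg a]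
      push_cast
      ring
    · rw [Set.indicator_of_notMem (by exact hrR)]
      have : ∀ θ : ℝ, h (circleMap 0 r θ) = 0 := by
        intro θ
        have hmem : circleMap 0 r θ ∉ Metric.ball (0 : ℂ) R := by
          simpa [abs_of_pos hr] using hrR
        rw [hh, Set.indicator_of_notMem hmem]
      simp [this]
  rw [setIntegral_congr_fun measurableSet_Ioi key, setIntegral_indicator measurableSet_Iio,
    Set.Ioi_inter_Iio, ← integral_Ioc_eq_integral_Ioo, ← intervalIntegral.integral_of_le hR.le,
    intervalIntegral.integral_mul_const, intervalIntegral.integral_ofReal,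
    integral_pow_mul_sq_sub_sq_pow]
  push_cast
  ring

theorem hasSum_taylorCoeff {g : ℂ → ℂ} {R : ℝ}
    (hg : DifferentiableOn ℂ g (Metric.ball 0 R)) {z : ℂ} (hz : ‖z‖ < R) :
    HasSum (fun a => z ^ a * taylorCoeff a g) (g z) := by
  have hz' : z ∈ Metric.ball (0 : ℂ) R := by simpa using hz
  convert! Complex.hasSum_taylorSeries_on_ball hg hz' using 2
  simp [taylorCoeff]
  ring

/-! ### Holomorphic dependence on parameters -/

-- Cauchy's estimate on each complex line through `x`; `δ < r` keeps the closed discs inside the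
-- ball.
open Metric in
theorem norm_fderiv_le_of_forall_mem_ball {E : Type*} [NormedAddCommGroup E] [NormedSpace ℂ E]
    {f : E → ℂ} {x : E} {r δ C : ℝ} (hδ : 0 < δ) (hδr : δ < r)
    (hf : DifferentiableOn ℂ f (ball x r)) (hC : ∀ y ∈ ball x r, ‖f y‖ ≤ C) :
    ‖fderiv ℂ f x‖ ≤ C / δ := by
  have hC0 : 0 ≤ C := (norm_nonneg _).trans (hC x (mem_ball_self (hδ.trans hδr)))
  refine ContinuousLinearMap.opNorm_le_bound _ (by positivity) fun v => ?_
  rcases eq_or_ne v 0 with rfl | hv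
  · simp
  have hv' : 0 < ‖v‖ := norm_pos_iff.2 hv
  have hmem : ∀ t ∈ closedBall (0 : ℂ) (δ / ‖v‖), x + t • v ∈ ball x r := by
    intro t ht
    rw [mem_closedBall_zero_iff, le_div_iff₀ hv'] at ht
    simp only [mem_ball, dist_self_add_left, norm_smul]
    linarith
  have hline : ∀ t : ℂ, HasDerivAt (fun t : ℂ => x + t • v) v t := fun t => by
    simpa using ((hasDerivAt_id t).smul_const v).const_add x
  have hdiff : DifferentiableOn ℂ (fun t : ℂ => f (x + t • v)) (closedBall 0 (δ / ‖v‖)) :=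
    hf.comp (fun t _ => (hline t).differentiableAt.differentiableWithinAt) hmem
  have h1 := Complex.norm_deriv_le_of_forall_mem_sphere_norm_le (div_pos hδ hv')
    (hdiff.diffContOnCl_ball subset_rfl)
    (fun t ht => hC _ (hmem t (sphere_subset_closedBall ht)))
  have hfx : HasFDerivAt f (fderiv ℂ f x) (x + (0 : ℂ) • v) := by
    rw [zero_smul, add_zero]
    exact (hf.differentiableAt (ball_mem_nhds x (hδ.trans hδr))).hasFDerivAt
  have h2 := (hfx.comp_hasDerivAt (0 : ℂ) (hline 0)).deriv
  change deriv (fun t : ℂ => f (x + t • v)) 0 = _ at h2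
  rw [h2] at h1
  calc ‖fderiv ℂ f x v‖ ≤ C / (δ / ‖v‖) := h1
    _ = C / δ * ‖v‖ := by field_simp

-- Differentiation under the integral sign. The derivative is dominated through Cauchy's estimate,
-- from a bound on `g` over a compact neighbourhood, so nothing need be known about continuity of
-- the derivative.
open Metric in
theorem differentiableAt_circleIntegral {E : Type*} [NormedAddCommGroup E] [NormedSpace ℂ E]
    [FiniteDimensional ℂ E] {g : ℂ × E → ℂ} {U : Set (ℂ × E)} (hU : IsOpen U)
    (hg : DifferentiableOn ℂ g U) {x₀ : E} {r : ℝ} (hr : 0 ≤ r)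
    (hsub : ∀ ζ ∈ sphere (0 : ℂ) r, (ζ, x₀) ∈ U) :
    DifferentiableAt ℂ (fun x => ∮ ζ in C(0, r), g (ζ, x)) x₀ := by
  have : ProperSpace E := FiniteDimensional.proper ℂ E
  have hcpt := isCompact_sphere (0 : ℂ) r
  obtain ⟨u, v, hu, hv, hsu, hxv, huv⟩ := generalized_tube_lemma hcpt
    (isCompact_singleton (x := x₀)) hU (by rintro ⟨ζ, x⟩ ⟨h1, rfl⟩; exact hsub ζ h1)
  obtain ⟨ε, hε, hεv⟩ := Metric.isOpen_iff.1 hv x₀ (hxv rfl)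
  have hK : sphere (0 : ℂ) r ×ˢ closedBall x₀ (ε / 2) ⊆ U := fun p hp => huv
    ⟨hsu hp.1, hεv (closedBall_subset_ball (by linarith) hp.2)⟩
  obtain ⟨C, hC⟩ := (hcpt.prod (isCompact_closedBall x₀ (ε / 2))).exists_bound_of_continuousOn
    (hg.continuousOn.mono hK)
  have hcm : ∀ θ, circleMap 0 r θ ∈ sphere (0 : ℂ) r := circleMap_mem_sphere 0 hr
  have hsl : ∀ ζ ∈ sphere (0 : ℂ) r, DifferentiableOn ℂ (fun x => g (ζ, x))
      (ball x₀ (ε / 2)) := fun ζ hζ => hg.comp (by fun_prop)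
        (fun x hx => hK ⟨hζ, ball_subset_closedBall hx⟩)
  have hdc : Continuous (deriv (circleMap 0 r)) := by
    rw [show deriv (circleMap 0 r) = fun θ => circleMap 0 r θ * Complex.I from
      funext fun θ => deriv_circleMap 0 r θ]
    fun_prop
  have hcont : ∀ x ∈ ball x₀ (ε / 2), Continuous fun θ : ℝ =>
      deriv (circleMap 0 r) θ • g (circleMap 0 r θ, x) := by
    intro x hx
    refine Continuous.smul hdc ?_
    exact hg.continuousOn.comp_continuous (by fun_prop)
      (fun θ => hK ⟨hcm θ, ball_subset_closedBall hx⟩)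
  -- Points vary within `ε/8`, and Cauchy's estimate there uses balls of radius `ε/4`, which stay
  -- where `‖g‖ ≤ C`; this gives the dominating constant `C / (ε/8)`.
  have hsmall : ∀ x ∈ ball x₀ (ε / 8), ball x (ε / 4) ⊆ ball x₀ (ε / 2) := by
    intro x hx
    refine ball_subset_ball' ?_
    rw [mem_ball] at hx
    linarith
  refine (intervalIntegral.hasFDerivAt_integral_of_dominated_of_fderiv_le (𝕜 := ℂ) (μ := volume)
    (F := fun x θ => deriv (circleMap 0 r) θ • g (circleMap 0 r θ, x))
    (F' := fun x θ => deriv (circleMap 0 r) θ • fderiv ℂ (fun y => g (circleMap 0 r θ, y)) x)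
    (bound := fun _ => r * (C / (ε / 8))) (ball_mem_nhds x₀ (ε := ε / 8) (by linarith))
    ?_ ?_ ?_ ?_ ?_ ?_).differentiableAt
  · filter_upwards [ball_mem_nhds x₀ (ε := ε / 2) (by linarith)] with x hx
    exact (hcont x hx).aestronglyMeasurable
  · exact (hcont x₀ (mem_ball_self (by linarith))).intervalIntegrable _ _
  · let : MeasurableSpace E := borel E
    have : BorelSpace E := ⟨rfl⟩
    have heq : ∀ θ, fderiv ℂ (fun y => g (circleMap 0 r θ, y)) x₀ =
        (fderiv ℂ g (circleMap 0 r θ, x₀)).comp (ContinuousLinearMap.inr ℂ ℂ E) := by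
      intro θ
      have h1 : HasFDerivAt g (fderiv ℂ g (circleMap 0 r θ, x₀)) (circleMap 0 r θ, x₀) :=
        (hg.differentiableAt (hU.mem_nhds (hsub _ (hcm θ)))).hasFDerivAt
      exact (h1.comp x₀ (hasFDerivAt_prodMk_right _ _)).fderiv
    simp_rw [heq]
    have hm : Measurable fun θ : ℝ => fderiv ℂ g (circleMap 0 r θ, x₀) :=
      (measurable_fderiv ℂ g).comp (by fun_prop)
    have hm2 : StronglyMeasurable fun θ : ℝ => fderiv ℂ g (circleMap 0 r θ, x₀) :=
      hm.stronglyMeasurable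
    have hc : Continuous fun T : (ℂ × E) →L[ℂ] ℂ => T.comp (ContinuousLinearMap.inr ℂ ℂ E) := by
      fun_prop
    have hm3 := hdc.stronglyMeasurable.smul (hc.comp_stronglyMeasurable hm2)
    exact hm3.aestronglyMeasurable
  · refine ae_of_all _ fun θ _ x hx => ?_
    have h1 : ‖deriv (circleMap 0 r) θ‖ = r := by simp [abs_of_nonneg hr]
    rw [norm_smul, h1]
    refine mul_le_mul_of_nonneg_left ?_ hr
    exact norm_fderiv_le_of_forall_mem_ball (r := ε / 4) (by linarith) (by linarith)
      ((hsl _ (hcm θ)).mono (hsmall x hx))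
      (fun y hy => hC (_, y) ⟨hcm θ, ball_subset_closedBall (hsmall x hx hy)⟩)
  · exact continuous_const.intervalIntegrable _ _
  · refine ae_of_all _ fun θ _ x hx => ?_
    have h1 : DifferentiableAt ℂ (fun y => g (circleMap 0 r θ, y)) x :=
      (hsl _ (hcm θ)).differentiableAt
        (isOpen_ball.mem_nhds (hsmall x hx (mem_ball_self (by linarith))))
    exact h1.hasFDerivAt.fun_const_smul _

/-- Taylor coefficients in the first variable depend holomorphically on the other variables. -/
theorem differentiableOn_taylorCoeff {E : Type*} [NormedAddCommGroup E] [NormedSpace ℂ E]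
    [FiniteDimensional ℂ E] {f : ℂ × E → ℂ} {D : Set E} (hD : IsOpen D) {R : E → ℝ}
    (hR : ContinuousOn R D) (hR0 : ∀ x ∈ D, 0 < R x)
    (hH : IsOpen {p : ℂ × E | p.2 ∈ D ∧ ‖p.1‖ < R p.2})
    (hf : DifferentiableOn ℂ f {p : ℂ × E | p.2 ∈ D ∧ ‖p.1‖ < R p.2}) (a : ℕ) :
    DifferentiableOn ℂ (fun x => taylorCoeff a fun ζ => f (ζ, x)) D := by
  intro x₀ hx₀
  refine DifferentiableAt.differentiableWithinAt ?_
  set r := R x₀ / 2 with hr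
  have h0 := hR0 x₀ hx₀
  have hr0 : 0 < r := by positivity
  have hnear : ∀ᶠ x in nhds x₀, x ∈ D ∧ r < R x :=
    Filter.Eventually.and (hD.mem_nhds hx₀)
      ((hR.continuousAt (hD.mem_nhds hx₀)).eventually (lt_mem_nhds (by rw [hr]; linarith)))
  have heq : (fun x => taylorCoeff a fun ζ => f (ζ, x)) =ᶠ[nhds x₀] fun x =>
      (2 * Real.pi * Complex.I)⁻¹ *
        ∮ ζ in C(0, r), (fun p : ℂ × E => (1 / (p.1 - 0) ^ (a + 1)) • f p) (ζ, x) := by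
    filter_upwards [hnear] with x hx
    have h1 : DifferentiableOn ℂ (fun ζ => f (ζ, x)) (Metric.ball 0 (R x)) :=
      hf.comp (by fun_prop) (fun ζ hζ => ⟨hx.1, by simpa using hζ⟩)
    rw [circleIntegral_eq_taylorCoeff hr0 hx.2 h1 a, inv_mul_cancel_left₀]
    exact Complex.two_pi_I_ne_zero
  refine DifferentiableAt.congr_of_eventuallyEq ?_ heq
  refine DifferentiableAt.const_mul ?_ _
  -- Removing `ζ = 0` from the domain makes the Cauchy integrand holomorphic; the circle avoids it.
  refine differentiableAt_circleIntegral
    (g := fun p : ℂ × E => (1 / (p.1 - 0) ^ (a + 1)) • f p)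
    (U := {p : ℂ × E | p.2 ∈ D ∧ ‖p.1‖ < R p.2} ∩ {p | p.1 ≠ 0})
    (hH.inter (isOpen_ne_fun continuous_fst continuous_const)) ?_ hr0.le ?_
  · have h1 : DifferentiableOn ℂ (fun p : ℂ × E => 1 / (p.1 - 0) ^ (a + 1))
        ({p : ℂ × E | p.2 ∈ D ∧ ‖p.1‖ < R p.2} ∩ {p | p.1 ≠ 0}) := by
      intro p hp
      have h2 : (p.1 - 0) ^ (a + 1) ≠ 0 := pow_ne_zero _ (by simpa using hp.2)
      have h3 : DifferentiableAt ℂ (fun p : ℂ × E => (p.1 - 0) ^ (a + 1)) p := by fun_prop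
      simpa only [one_div] using (h3.fun_inv h2).differentiableWithinAt
    exact h1.smul (hf.mono Set.inter_subset_left)
  · intro ζ hζ
    rw [mem_sphere_zero_iff_norm] at hζ
    refine ⟨⟨hx₀, ?_⟩, ?_⟩
    · simp only [hζ, hr]; linarith
    · intro h
      simp only at h
      rw [h, norm_zero] at hζ
      linarith

/-! ### Fibre integration over Hartogs domains -/

/-- The Hartogs domain over `D` whose fibre over `x` is the disc of radius `R x`. -/
def hartogsSet {E : Type*} (D : Set E) (R : E → ℝ) : Set (ℂ × E) :=
  {p | p.2 ∈ D ∧ ‖p.1‖ < R p.2}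

/-- Fubini, with `integral_ball_mul_conj_pow` on each fibre. Integrability over the base is recorded
because the reproducing property of the base needs it as input. -/
theorem setIntegral_hartogsSet {E : Type*} [MeasurableSpace E] {μ : Measure E} [SFinite μ]
    {D : Set E} (hD : MeasurableSet D) {R : E → ℝ} (hR0 : ∀ x ∈ D, 0 < R x)
    (hH : MeasurableSet (hartogsSet D R)) {f : ℂ × E → ℂ}
    (hf : ∀ x ∈ D, DifferentiableOn ℂ (fun ζ => f (ζ, x)) (Metric.ball 0 (R x)))
    (a s : ℕ) (q : E → ℂ)
    (hi : IntegrableOn (fun p : ℂ × E =>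
      f p * ((R p.2 ^ 2 - ‖p.1‖ ^ 2) ^ s : ℝ) * (conj p.1 ^ a * q p.2))
      (hartogsSet D R) (volume.prod μ)) :
    IntegrableOn (fun x => R x ^ (2 * (a + s + 1)) * taylorCoeff a (fun ζ => f (ζ, x)) * q x) D μ ∧
    ∫ p in hartogsSet D R,
        f p * ((R p.2 ^ 2 - ‖p.1‖ ^ 2) ^ s : ℝ) * (conj p.1 ^ a * q p.2) ∂(volume.prod μ) =
      Real.pi * betaConst a s *
        ∫ x in D, R x ^ (2 * (a + s + 1)) * taylorCoeff a (fun ζ => f (ζ, x)) * q x ∂μ := by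
  set F : ℂ × E → ℂ := fun p =>
    f p * ((R p.2 ^ 2 - ‖p.1‖ ^ 2) ^ s : ℝ) * (conj p.1 ^ a * q p.2) with hF
  set c : ℂ := Real.pi * betaConst a s with hc
  have hc0 : c ≠ 0 := by
    have h1 : betaConst a s ≠ 0 := by
      unfold betaConst
      positivity
    rw [hc]
    exact mul_ne_zero (by exact_mod_cast Real.pi_ne_zero) (by exact_mod_cast h1)
  have hint : Integrable ((hartogsSet D R).indicator F) (volume.prod μ) :=
    (integrable_indicator_iff hH).2 hi
  have hfib : ∀ᵐ x ∂μ, ∫ ζ, (hartogsSet D R).indicator F (ζ, x) =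
      D.indicator (fun x => c * (R x ^ (2 * (a + s + 1)) *
        taylorCoeff a (fun ζ => f (ζ, x)) * q x)) x := by
    filter_upwards [hint.prod_left_ae] with x hx
    by_cases hxD : x ∈ D
    · rw [Set.indicator_of_mem hxD]
      have hsec : ∀ ζ, (hartogsSet D R).indicator F (ζ, x) =
          (Metric.ball (0 : ℂ) (R x)).indicator (fun ζ => (f (ζ, x) *
            ((R x ^ 2 - ‖ζ‖ ^ 2) ^ s : ℝ) * conj ζ ^ a) * q x) ζ := by
        intro ζ
        by_cases hζ : ‖ζ‖ < R x
        · rw [Set.indicator_of_mem (show (ζ, x) ∈ hartogsSet D R from ⟨hxD, hζ⟩),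
            Set.indicator_of_mem (by simpa using hζ), hF]
          ring
        · rw [Set.indicator_of_notMem (fun h : (ζ, x) ∈ hartogsSet D R => hζ h.2),
            Set.indicator_of_notMem (by simpa using hζ)]
      simp_rw [hsec] at hx ⊢
      rw [integral_indicator Metric.isOpen_ball.measurableSet, integral_mul_const]
      -- If `q x ≠ 0` it can be divided out to recover integrability on the fibre; otherwise both
      -- sides vanish.
      by_cases hq : q x = 0
      · simp [hq]
      rw [integrable_indicator_iff Metric.isOpen_ball.measurableSet] at hx
      have hx' := hx.mul_const (q x)⁻¹
      simp only [mul_assoc, mul_inv_cancel₀ hq, mul_one] at hx'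
      simp only [← mul_assoc] at hx'
      rw [integral_ball_mul_conj_pow (hR0 x hxD) (hf x hxD) a s hx', hc]
      ring
    · rw [Set.indicator_of_notMem hxD]
      have : ∀ ζ, (hartogsSet D R).indicator F (ζ, x) = 0 := fun ζ =>
        Set.indicator_of_notMem (fun h => hxD h.1) _
      simp [this]
  constructor
  · have h1 := (integrable_congr hfib).1 hint.integral_prod_right
    rw [integrable_indicator_iff hD] at h1
    have h2 := h1.const_mul c⁻¹
    simp only [inv_mul_cancel_left₀ hc0] at h2
    exact h2
  · rw [← integral_indicator hH, integral_prod_symm _ hint, integral_congr_ae hfib,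
      integral_indicator hD, integral_const_mul]

/-- Termwise integration by the Weierstrass majorant `B`, with `F` integrable. -/
theorem hasSum_setIntegral_mul {α : Type*} [MeasurableSpace α] {μ : Measure α} {H : Set α}
    (hH : MeasurableSet H) {F k : α → ℂ} (hF : IntegrableOn F H μ) {t : ℕ → α → ℂ}
    (ht : ∀ a, Measurable (t a)) {B : ℕ → ℝ} (hB : Summable B) (htB : ∀ a, ∀ p ∈ H, ‖t a p‖ ≤ B a)
    (hk : ∀ p ∈ H, HasSum (fun a => t a p) (k p)) :
    (∀ a, IntegrableOn (fun p => F p * t a p) H μ) ∧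
    HasSum (fun a => ∫ p in H, F p * t a p ∂μ) (∫ p in H, F p * k p ∂μ) := by
  have hi : ∀ a, IntegrableOn (fun p => F p * t a p) H μ := fun a =>
    hF.mul_bdd (c := B a) (ht a).aestronglyMeasurable
      ((ae_restrict_iff' hH).2 (ae_of_all _ (htB a)))
  refine ⟨hi, ?_⟩
  have hs : Summable fun a => ∫ p in H, ‖F p * t a p‖ ∂μ := by
    refine Summable.of_nonneg_of_le (fun a => integral_nonneg fun _ => norm_nonneg _) (fun a => ?_)
      (hB.mul_left (∫ p in H, ‖F p‖ ∂μ))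
    rw [← integral_mul_const]
    refine setIntegral_mono_on (hi a).norm (hF.norm.mul_const _) hH fun p hp => ?_
    rw [norm_mul]
    exact mul_le_mul_of_nonneg_left (htB a p hp) (norm_nonneg _)
  have h1 := hasSum_integral_of_summable_integral_norm hi hs
  have h2 : ∫ p in H, F p * k p ∂μ = ∫ p in H, ∑' a, F p * t a p ∂μ :=
    setIntegral_congr_fun hH fun p hp => (((hk p hp).mul_left (F p)).tsum_eq).symm
  rwa [h2]

/-! ### Weighted Bergman kernels of the Euclidean ball -/

/-- The squared Euclidean norm on `Fin m → ℂ`. -/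
noncomputable def sqNorm {m : ℕ} (x : Fin m → ℂ) : ℝ := ∑ i, ‖x i‖ ^ 2

/-- The Hermitian product on `Fin m → ℂ`, linear in the first argument. -/
noncomputable def hermProd {m : ℕ} (z w : Fin m → ℂ) : ℂ := ∑ i, z i * conj (w i)

/-- The open unit ball of `Fin m → ℂ` for the Euclidean norm. -/
def euclBall (m : ℕ) : Set (Fin m → ℂ) := {x | sqNorm x < 1}

theorem continuous_sqNorm {m : ℕ} : Continuous (sqNorm : (Fin m → ℂ) → ℝ) := by
  unfold sqNorm
  fun_prop

theorem continuous_hermProd {m : ℕ} (z : Fin m → ℂ) : Continuous (hermProd z) := by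
  unfold hermProd
  fun_prop

theorem sqNorm_nonneg {m : ℕ} (x : Fin m → ℂ) : 0 ≤ sqNorm x :=
  Finset.sum_nonneg fun _ _ => by positivity

theorem isOpen_euclBall (m : ℕ) : IsOpen (euclBall m) :=
  isOpen_lt continuous_sqNorm continuous_const

theorem sqNorm_cons {m : ℕ} (ζ : ℂ) (x : Fin m → ℂ) :
    sqNorm (Fin.cons ζ x : Fin (m + 1) → ℂ) = ‖ζ‖ ^ 2 + sqNorm x := by
  simp [sqNorm, Fin.sum_univ_succ]

theorem hermProd_cons {m : ℕ} (z : Fin (m + 1) → ℂ) (ζ : ℂ) (x : Fin m → ℂ) :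
    hermProd z (Fin.cons ζ x : Fin (m + 1) → ℂ) = z 0 * conj ζ + hermProd (Fin.tail z) x := by
  simp [hermProd, Fin.sum_univ_succ, Fin.tail]

theorem norm_hermProd_le {m : ℕ} (z x : Fin m → ℂ) :
    ‖hermProd z x‖ ≤ √(sqNorm z) * √(sqNorm x) := by
  refine (norm_sum_le _ _).trans ?_
  simp only [norm_mul, RCLike.norm_conj]
  exact Real.sum_mul_le_sqrt_mul_sqrt _ _ _

theorem one_sub_le_norm_one_sub_hermProd {m : ℕ} (z x : Fin m → ℂ) :
    1 - √(sqNorm z) * √(sqNorm x) ≤ ‖1 - hermProd z x‖ := by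
  have h1 := norm_sub_norm_le (1 : ℂ) (hermProd z x)
  have h2 := norm_hermProd_le z x
  rw [norm_one] at h1
  linarith

theorem differentiable_uncurry_finCons {m : ℕ} :
    Differentiable ℂ fun p : ℂ × (Fin m → ℂ) => (Fin.cons p.1 p.2 : Fin (m + 1) → ℂ) := by
  rw [differentiable_pi]
  intro i
  refine Fin.cases ?_ (fun j => ?_) i
  · simp only [Fin.cons_zero]
    fun_prop
  · simp only [Fin.cons_succ]
    fun_prop

theorem measurePreserving_finCons (m : ℕ) :
    MeasurePreserving (fun p : ℂ × (Fin m → ℂ) => (Fin.cons p.1 p.2 : Fin (m + 1) → ℂ))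
      (volume.prod volume) volume ∧
    MeasurableEmbedding
      (fun p : ℂ × (Fin m → ℂ) => (Fin.cons p.1 p.2 : Fin (m + 1) → ℂ)) := by
  have h : (fun p : ℂ × (Fin m → ℂ) => (Fin.cons p.1 p.2 : Fin (m + 1) → ℂ)) =
      (MeasurableEquiv.piFinSuccAbove (fun _ : Fin (m + 1) => ℂ) 0).symm := by
    funext p
    simp [MeasurableEquiv.piFinSuccAbove, Fin.insertNthEquiv]
  rw [h]
  exact ⟨(volume_preserving_piFinSuccAbove (fun _ : Fin (m + 1) => ℂ) 0).symm,
    MeasurableEquiv.measurableEmbedding _⟩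

theorem setIntegral_finCons {m : ℕ} (S : Set (Fin (m + 1) → ℂ)) (G : (Fin (m + 1) → ℂ) → ℂ) :
    ∫ w in S, G w = ∫ p in {p : ℂ × (Fin m → ℂ) | (Fin.cons p.1 p.2 : Fin (m + 1) → ℂ) ∈ S},
      G (Fin.cons p.1 p.2) ∂(volume.prod volume) :=
  ((measurePreserving_finCons m).1.setIntegral_preimage_emb
    (measurePreserving_finCons m).2 G S).symm

theorem integrableOn_finCons {m : ℕ} {S : Set (Fin (m + 1) → ℂ)} {G : (Fin (m + 1) → ℂ) → ℂ} :
    IntegrableOn (fun p : ℂ × (Fin m → ℂ) => G (Fin.cons p.1 p.2))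
      {p : ℂ × (Fin m → ℂ) | (Fin.cons p.1 p.2 : Fin (m + 1) → ℂ) ∈ S} (volume.prod volume) ↔
    IntegrableOn G S :=
  (measurePreserving_finCons m).1.integrableOn_comp_preimage (measurePreserving_finCons m).2

/-- The weighted Bergman kernels of the ball of `ℂᵐ` with weights `(1 - |w|²)ˢ` reproduce
integrable holomorphic functions. -/
def BallReproducing (m : ℕ) : Prop :=
  ∀ (s : ℕ) (f : (Fin m → ℂ) → ℂ), DifferentiableOn ℂ f (euclBall m) →
    IntegrableOn (fun w => ((1 - sqNorm w : ℝ) : ℂ) ^ s * f w) (euclBall m) →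
    ∀ z ∈ euclBall m,
      ∫ w in euclBall m, ((1 - sqNorm w : ℝ) : ℂ) ^ s * f w *
        ((1 - hermProd z w) ^ (m + 1 + s))⁻¹ =
      (Real.pi : ℂ) ^ m * (s.factorial / (m + s).factorial) * f z

theorem isOpen_hartogsSet {E : Type*} [TopologicalSpace E] {D : Set E} (hD : IsOpen D) {R : E → ℝ}
    (hR : Continuous R) : IsOpen (hartogsSet D R) :=
  (hD.preimage continuous_snd).inter
    (isOpen_lt (continuous_norm.comp continuous_fst) (hR.comp continuous_snd))

/-- If the kernel `k` on a Hartogs domain over the ball has a suitable expansion in the first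
variable, it inherits the reproducing property from the ball. -/
theorem BallReproducing.setIntegral_hartogsSet {m : ℕ} (hm : BallReproducing m)
    {R : (Fin m → ℂ) → ℝ} (hR : Continuous R) (hR0 : ∀ x ∈ euclBall m, 0 < R x)
    (hR1 : ∀ x ∈ euclBall m, R x ≤ 1) (s : ℕ) (p : ℕ → ℕ)
    (hp : ∀ x ∈ euclBall m, ∀ a, R x ^ (2 * (a + s + 1)) = (1 - sqNorm x) ^ p a)
    {f : ℂ × (Fin m → ℂ) → ℂ} (hf : DifferentiableOn ℂ f (hartogsSet (euclBall m) R))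
    (hi : IntegrableOn (fun q : ℂ × (Fin m → ℂ) => f q * ((R q.2 ^ 2 - ‖q.1‖ ^ 2) ^ s : ℝ))
      (hartogsSet (euclBall m) R) (volume.prod volume))
    {ζ₀ : ℂ} {z : Fin m → ℂ} (hz : (ζ₀, z) ∈ hartogsSet (euclBall m) R)
    {κ : ℕ → ℂ} {c : ℂ}
    (hκ : ∀ a, κ a * (Real.pi * betaConst a s) *
      ((Real.pi : ℂ) ^ m * ((p a).factorial / (m + p a).factorial)) = c)
    {k : ℂ × (Fin m → ℂ) → ℂ}
    (hk : ∀ q ∈ hartogsSet (euclBall m) R, HasSum (fun a => conj q.1 ^ a *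
      (κ a * ζ₀ ^ a * ((1 - hermProd z q.2) ^ (m + 1 + p a))⁻¹)) (k q))
    {B : ℕ → ℝ} (hB : Summable B)
    (hkB : ∀ a, ∀ q ∈ hartogsSet (euclBall m) R, ‖conj q.1 ^ a *
      (κ a * ζ₀ ^ a * ((1 - hermProd z q.2) ^ (m + 1 + p a))⁻¹)‖ ≤ B a) :
    ∫ q in hartogsSet (euclBall m) R, f q * ((R q.2 ^ 2 - ‖q.1‖ ^ 2) ^ s : ℝ) * k q
      ∂(volume.prod volume) = c * f (ζ₀, z) := by
  have hHo := isOpen_hartogsSet (isOpen_euclBall m) hR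
  have hDm := (isOpen_euclBall m).measurableSet
  have hfib : ∀ x ∈ euclBall m, DifferentiableOn ℂ (fun ζ => f (ζ, x)) (Metric.ball 0 (R x)) :=
    fun x hx => hf.comp (by fun_prop) (fun ζ hζ => ⟨hx, by simpa using hζ⟩)
  have hmeas : ∀ a, Measurable fun q : ℂ × (Fin m → ℂ) => conj q.1 ^ a *
      (κ a * ζ₀ ^ a * ((1 - hermProd z q.2) ^ (m + 1 + p a))⁻¹) := by
    intro a
    have h1 := (continuous_hermProd z).measurable
    refine Measurable.mul (by fun_prop) (Measurable.const_mul (Measurable.inv ?_) _)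
    exact ((h1.comp measurable_snd).const_sub 1).pow_const _
  obtain ⟨hint, hsum⟩ := hasSum_setIntegral_mul hHo.measurableSet hi hmeas hB hkB hk
  have hterm : ∀ a, ∫ q in hartogsSet (euclBall m) R,
      f q * ((R q.2 ^ 2 - ‖q.1‖ ^ 2) ^ s : ℝ) * (conj q.1 ^ a *
        (κ a * ζ₀ ^ a * ((1 - hermProd z q.2) ^ (m + 1 + p a))⁻¹)) ∂(volume.prod volume) =
      c * (ζ₀ ^ a * taylorCoeff a fun ζ => f (ζ, z)) := by
    intro a
    -- Taking `q = 1` yields integrability of the weighted coefficient on the ball; the factor `ζ̄ᵃ`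
    -- is harmless because `R ≤ 1`.
    have hone := (_root_.setIntegral_hartogsSet hDm hR0 hHo.measurableSet hfib a s
      (fun _ => 1) (by
        refine Integrable.mul_bdd (c := 1) hi (by fun_prop)
          ((ae_restrict_iff' hHo.measurableSet).2 (ae_of_all _ fun q hq => ?_))
        simp only [mul_one, norm_pow, RCLike.norm_conj]
        exact pow_le_one₀ (norm_nonneg _) (hq.2.le.trans (hR1 _ hq.1)))).1
    have hpow : ∀ x ∈ euclBall m,
        (R x : ℂ) ^ (2 * (a + s + 1)) = ((1 - sqNorm x : ℝ) : ℂ) ^ p a := by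
      intro x hx
      exact_mod_cast hp x hx a
    have hball := hm (p a) (fun x => taylorCoeff a fun ζ => f (ζ, x))
      (differentiableOn_taylorCoeff (isOpen_euclBall m) hR.continuousOn hR0 hHo hf a)
      (hone.congr_fun (fun x hx => by simp only [mul_one, hpow x hx]) hDm) z hz.1
    have hcongr : ∫ x in euclBall m, (R x : ℂ) ^ (2 * (a + s + 1)) *
        (taylorCoeff a fun ζ => f (ζ, x)) *
        (κ a * ζ₀ ^ a * ((1 - hermProd z x) ^ (m + 1 + p a))⁻¹) =
        ∫ x in euclBall m, κ a * ζ₀ ^ a * (((1 - sqNorm x : ℝ) : ℂ) ^ p a *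
        (taylorCoeff a fun ζ => f (ζ, x)) * ((1 - hermProd z x) ^ (m + 1 + p a))⁻¹) := by
      refine setIntegral_congr_fun hDm fun x hx => ?_
      simp only [hpow x hx]
      ring
    -- Now `q` is the `x`-dependent part of the `a`-th kernel term, and the base integral is the one
    -- just evaluated on the ball.
    have h1 := (_root_.setIntegral_hartogsSet hDm hR0 hHo.measurableSet hfib a s
      (fun x => κ a * ζ₀ ^ a * ((1 - hermProd z x) ^ (m + 1 + p a))⁻¹) (hint a)).2
    rw [h1, hcongr, integral_const_mul, hball, ← hκ a]
    ring
  simp_rw [hterm] at hsum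
  exact hsum.unique ((hasSum_taylorCoeff (hfib z hz.1) hz.2).mul_left c)

theorem setOf_finCons_mem_euclBall (m : ℕ) :
    {p : ℂ × (Fin m → ℂ) | (Fin.cons p.1 p.2 : Fin (m + 1) → ℂ) ∈ euclBall (m + 1)} =
      hartogsSet (euclBall m) fun x => √(1 - sqNorm x) := by
  ext p
  simp only [euclBall, Set.mem_ofPred_eq, sqNorm_cons, hartogsSet, Real.lt_sqrt (norm_nonneg _)]
  constructor
  · intro h
    exact ⟨by nlinarith [sq_nonneg ‖p.1‖], by linarith⟩
  · rintro ⟨-, h⟩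
    linarith

/-- With `A = |z|`, `X = |x|` and `ρ` the square root on the right, Cauchy–Schwarz in the plane
gives `|ζ₀||ζ| + AX ≤ ρ`, hence `|ζ₀ζ| ≤ ρ - AX ≤ ρ(1 - AX)` since `ρ < 1`. The ratio `ρ` does not
depend on `(ζ, x)`, so it supplies a geometric majorant. -/
theorem norm_mul_le_mul_norm_one_sub_hermProd {m : ℕ} {ζ₀ ζ : ℂ} {z x : Fin m → ℂ}
    (hz : ‖ζ₀‖ ^ 2 + sqNorm z < 1) (hx : ‖ζ‖ ^ 2 + sqNorm x < 1) :
    ‖ζ₀ * conj ζ‖ ≤ √(‖ζ₀‖ ^ 2 + sqNorm z) * ‖1 - hermProd z x‖ := by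
  have h1 := one_sub_le_norm_one_sub_hermProd z x
  have hA := Real.sq_sqrt (sqNorm_nonneg z)
  have hX := Real.sq_sqrt (sqNorm_nonneg x)
  have hA0 := Real.sqrt_nonneg (sqNorm z)
  have hX0 := Real.sqrt_nonneg (sqNorm x)
  set A := √(sqNorm z)
  set X := √(sqNorm x)
  rw [← hA] at hz ⊢
  rw [← hX] at hx
  have hρ0 := Real.sqrt_nonneg (‖ζ₀‖ ^ 2 + A ^ 2)
  have hρ := Real.sq_sqrt (show 0 ≤ ‖ζ₀‖ ^ 2 + A ^ 2 by positivity)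
  set ρ := √(‖ζ₀‖ ^ 2 + A ^ 2)
  have hρ1 : ρ < 1 := by nlinarith
  rw [norm_mul, RCLike.norm_conj]
  have hcs : ‖ζ₀‖ * ‖ζ‖ + A * X ≤ ρ := by
    refine abs_le_of_sq_le_sq' ?_ hρ0 |>.2
    rw [hρ]
    nlinarith [sq_nonneg (‖ζ₀‖ * X - A * ‖ζ‖), sq_nonneg ‖ζ₀‖, sq_nonneg A]
  have : ρ * (1 - A * X) ≤ ρ * ‖1 - hermProd z x‖ := mul_le_mul_of_nonneg_left h1 hρ0
  nlinarith [mul_nonneg hA0 hX0]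

theorem one_sub_sqrt_le_norm_one_sub_hermProd {m : ℕ} {z x : Fin m → ℂ} (hx : x ∈ euclBall m) :
    1 - √(sqNorm z) ≤ ‖1 - hermProd z x‖ := by
  have h1 := one_sub_le_norm_one_sub_hermProd z x
  have h2 : √(sqNorm x) ≤ 1 := Real.sqrt_le_one.2 (le_of_lt hx)
  nlinarith [Real.sqrt_nonneg (sqNorm z)]

theorem sqrt_sqNorm_lt_one {m : ℕ} {z : Fin m → ℂ} (hz : z ∈ euclBall m) : √(sqNorm z) < 1 := by
  rw [Real.sqrt_lt' one_pos, one_pow]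
  exact hz

theorem one_sub_hermProd_ne_zero {m : ℕ} {z x : Fin m → ℂ} (hz : z ∈ euclBall m)
    (hx : x ∈ euclBall m) : 1 - hermProd z x ≠ 0 := by
  rw [← norm_pos_iff]
  linarith [one_sub_sqrt_le_norm_one_sub_hermProd (z := z) hx, sqrt_sqNorm_lt_one hz]

theorem norm_conj_pow_mul_inv (ζ ζ₀ c d : ℂ) (j l a : ℕ) :
    ‖conj ζ ^ a * (c * ζ₀ ^ a * (d ^ (j + l * a))⁻¹)‖ =
      ‖c‖ * (‖ζ₀ * conj ζ‖ / ‖d‖ ^ l) ^ a * (‖d‖ ^ j)⁻¹ := by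
  rw [pow_add, pow_mul]
  simp only [norm_mul, norm_pow, norm_inv, mul_pow, mul_inv, div_eq_mul_inv]
  ring

/-- Induction on dimension: the ball is a Hartogs domain over the ball one dimension lower with `R²
= 1 - |x|²`, and its weight is `(R² - |ζ|²)ˢ`. The kernel is expanded in `z₁ ζ̄ / (1 - ⟨z',x⟩)` by
the negative binomial series. -/
theorem ballReproducing (m : ℕ) : BallReproducing m := by
  induction m with
  | zero =>
    intro s f _ _ z _
    have h1 : euclBall 0 = Set.univ := by
      ext x
      simp [euclBall, sqNorm]
    have h2 : (s.factorial : ℂ) ≠ 0 := by exact_mod_cast s.factorial_ne_zero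
    rw [h1, setIntegral_univ, integral_unique]
    simp [sqNorm, hermProd, h2, Measure.real, volume_pi]
    exact congrArg f (Subsingleton.elim _ _)
  | succ m ih =>
    intro s f hf hi z hz
    have hset := setOf_finCons_mem_euclBall m
    have hcons : (Fin.cons (z 0) (Fin.tail z) : Fin (m + 1) → ℂ) = z := Fin.cons_self_tail z
    have hzH : (z 0, Fin.tail z) ∈ hartogsSet (euclBall m) fun x => √(1 - sqNorm x) := by
      rw [← hset]
      simpa only [Set.mem_ofPred_eq, hcons] using hz
    have hz1 : ‖z 0‖ ^ 2 + sqNorm (Fin.tail z) < 1 := by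
      rw [← sqNorm_cons, hcons]
      exact hz
    have hmem : ∀ q ∈ hartogsSet (euclBall m) (fun x => √(1 - sqNorm x)),
        ‖q.1‖ ^ 2 + sqNorm q.2 < 1 := by
      intro q hq
      rw [← hset] at hq
      rw [← sqNorm_cons]
      exact hq
    have hpos : ∀ x ∈ euclBall m, 0 < 1 - sqNorm x := fun x hx => sub_pos.2 hx
    have hw : ∀ q ∈ hartogsSet (euclBall m) (fun x => √(1 - sqNorm x)),
        √(1 - sqNorm q.2) ^ 2 - ‖q.1‖ ^ 2 =
          1 - sqNorm (Fin.cons q.1 q.2 : Fin (m + 1) → ℂ) := by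
      intro q hq
      rw [Real.sq_sqrt (hpos _ hq.1).le, sqNorm_cons]
      ring
    have hHm := (isOpen_hartogsSet (isOpen_euclBall m) (R := fun x => √(1 - sqNorm x))
      (by have := continuous_sqNorm (m := m); fun_prop)).measurableSet
    set ρ := √(‖z 0‖ ^ 2 + sqNorm (Fin.tail z)) with hρ
    have hρ0 : 0 ≤ ρ := Real.sqrt_nonneg _
    have hρ1 : ρ < 1 := by
      rw [hρ, Real.sqrt_lt' one_pos]
      simpa using hz1
    set δ := 1 - √(sqNorm (Fin.tail z)) with hδ
    have hδ0 : 0 < δ := by linarith [sqrt_sqNorm_lt_one hzH.1]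
    have hB : Summable fun a : ℕ =>
        ((a + (m + 1 + s)).choose (m + 1 + s) : ℝ) * ρ ^ a * (δ ^ (m + 1 + s + 1))⁻¹ := by
      have h1 : ‖ρ‖ < 1 := by rwa [Real.norm_of_nonneg hρ0]
      exact (summable_choose_mul_geometric_of_norm_lt_one (m + 1 + s) h1).mul_right _
    have hmain := ih.setIntegral_hartogsSet (R := fun x => √(1 - sqNorm x))
      (by have := continuous_sqNorm (m := m); fun_prop)
      (fun x hx => Real.sqrt_pos.2 (hpos x hx))
      (fun x _ => Real.sqrt_le_one.2 (by linarith [sqNorm_nonneg x])) s (fun a => a + s + 1)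
      (fun x hx a => by rw [pow_mul, Real.sq_sqrt (hpos x hx).le])
      (f := fun p => f (Fin.cons p.1 p.2))
      (hf.comp differentiable_uncurry_finCons.differentiableOn
        (fun q hq => by rw [← hset] at hq; exact hq))
      (by
        rw [← integrableOn_finCons, hset] at hi
        refine hi.congr_fun (fun q hq => ?_) hHm
        simp only
        rw [← hw q hq, mul_comm]
        push_cast
        rfl)
      hzH (κ := fun a => ((a + (m + 1 + s)).choose (m + 1 + s) : ℂ))
      (c := (Real.pi : ℂ) ^ (m + 1) * (s.factorial / (m + 1 + s).factorial))
      -- The binomial coefficient cancels the `a`-dependence of the beta constant times the constant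
      -- of the lower ball with weight exponent `a + s + 1`.
      (fun a => by
        have h1 : ((a + (m + 1 + s)).choose (m + 1 + s) : ℂ) * (a.factorial *
            (m + 1 + s).factorial) = (m + (a + s + 1)).factorial := by
          rw [show m + (a + s + 1) = a + (m + 1 + s) by ring,
            ← Nat.add_choose_mul_factorial_mul_factorial a (m + 1 + s)]
          push_cast
          ring
        have h2 : ((a + s + 1).factorial : ℂ) ≠ 0 := by exact_mod_cast Nat.factorial_ne_zero _
        have h3 : ((m + (a + s + 1)).factorial : ℂ) ≠ 0 := by
          exact_mod_cast Nat.factorial_ne_zero _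
        have h4 : ((m + 1 + s).factorial : ℂ) ≠ 0 := by exact_mod_cast Nat.factorial_ne_zero _
        simp only [betaConst]
        push_cast
        field_simp
        rw [← h1]
        ring)
      (k := fun q => ((1 - hermProd z (Fin.cons q.1 q.2 : Fin (m + 1) → ℂ)) ^ (m + 1 + 1 + s))⁻¹)
      (fun q hq => by
        have hne := one_sub_hermProd_ne_zero hzH.1 hq.1
        have hv : ‖z 0 * conj q.1 / (1 - hermProd (Fin.tail z) q.2)‖ < 1 := by
          rw [norm_div, div_lt_one (norm_pos_iff.2 hne)]
          refine (norm_mul_le_mul_norm_one_sub_hermProd hz1 (hmem q hq)).trans_lt ?_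
          exact mul_lt_of_lt_one_left (norm_pos_iff.2 hne) hρ1
        have h1 := (hasSum_choose_mul_geometric_of_norm_lt_one (m + 1 + s) hv).mul_left
          ((1 - hermProd (Fin.tail z) q.2) ^ (m + 1 + s + 1))⁻¹
        convert! h1 using 1
        · funext a
          rw [show m + 1 + (a + s + 1) = m + 1 + s + 1 + a by ring, pow_add _ _ a, div_pow, mul_pow]
          field_simp
        · rw [hermProd_cons, one_div, ← mul_inv, ← mul_pow, mul_sub, mul_div_cancel₀ _ hne,
            show m + 1 + 1 + s = m + 1 + s + 1 by ring]
          ring)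
      (B := fun a => ((a + (m + 1 + s)).choose (m + 1 + s) : ℝ) * ρ ^ a * (δ ^ (m + 1 + s + 1))⁻¹)
      hB
      (fun a q hq => by
        have hne := norm_pos_iff.2 (one_sub_hermProd_ne_zero hzH.1 hq.1)
        have h1 := norm_mul_le_mul_norm_one_sub_hermProd hz1 (hmem q hq)
        have h2 := one_sub_sqrt_le_norm_one_sub_hermProd (z := Fin.tail z) hq.1
        simp only [show m + 1 + (a + s + 1) = (m + 1 + s + 1) + 1 * a by ring]
        rw [norm_conj_pow_mul_inv, RCLike.norm_natCast, pow_one]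
        have h4 : ‖z 0 * conj q.1‖ / ‖1 - hermProd (Fin.tail z) q.2‖ ≤ ρ :=
          (div_le_iff₀ hne).2 h1
        gcongr)
    simp only [hcons] at hmain
    rw [← hmain, setIntegral_finCons, hset]
    refine setIntegral_congr_fun hHm fun q hq => ?_
    rw [← hw q hq]
    push_cast
    ring

/-! ### Even and odd parts of a binomial power -/

/-- The polynomials `(E, O)` with `(1 + s) ^ N = E (s ^ 2) + s * O (s ^ 2)`. -/
noncomputable def evenOddParts (u : ℂ) : ℕ → ℂ × ℂ
  | 0 => (1, 0)
  | N + 1 => ((evenOddParts u N).1 + u * (evenOddParts u N).2,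
      (evenOddParts u N).1 + (evenOddParts u N).2)

theorem one_add_pow_eq_evenOddParts (s : ℂ) (N : ℕ) :
    (1 + s) ^ N = (evenOddParts (s ^ 2) N).1 + s * (evenOddParts (s ^ 2) N).2 := by
  induction N with
  | zero => simp [evenOddParts]
  | succ N ih =>
    rw [pow_succ, ih]
    simp only [evenOddParts]
    ring

theorem two_mul_evenOddParts_snd (s : ℂ) (N : ℕ) :
    2 * s * (evenOddParts (s ^ 2) N).2 = (1 + s) ^ N - (1 - s) ^ N := by
  have h := one_add_pow_eq_evenOddParts (-s) N
  rw [neg_sq] at h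
  rw [sub_eq_add_neg 1 s, h, one_add_pow_eq_evenOddParts s N]
  ring

theorem evenOddParts_zero (N : ℕ) : evenOddParts 0 N = (1, (N : ℂ)) := by
  induction N with
  | zero => simp [evenOddParts]
  | succ N ih =>
    simp [evenOddParts, ih]
    ring

theorem conj_evenOddParts (u : ℂ) (N : ℕ) :
    conj (evenOddParts u N).1 = (evenOddParts (conj u) N).1 ∧
    conj (evenOddParts u N).2 = (evenOddParts (conj u) N).2 := by
  induction N with
  | zero => simp [evenOddParts]
  | succ N ih => simp [evenOddParts, ih.1, ih.2]

theorem differentiable_evenOddParts (N : ℕ) :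
    Differentiable ℂ (fun u => (evenOddParts u N).1) ∧
    Differentiable ℂ (fun u => (evenOddParts u N).2) := by
  induction N with
  | zero => simp [evenOddParts]
  | succ N ih =>
    simp only [evenOddParts]
    exact ⟨ih.1.add (differentiable_id.mul ih.2), ih.1.add ih.2⟩

/-- With `u = s²`, this is the odd part of `∑ C(k+n, n) sᵏ = (1 - s)^-(n+1)`, divided by `s`; the
common denominator of the series at `s` and `-s` is `(1 - u)^(n+1)`. -/
theorem hasSum_choose_odd_mul_pow (n : ℕ) {u : ℂ} (hu : ‖u‖ < 1) :
    HasSum (fun a : ℕ => ((2 * a + 1 + n).choose n : ℂ) * u ^ a)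
      ((evenOddParts u (n + 1)).2 / (1 - u) ^ (n + 1)) := by
  obtain ⟨s, hs⟩ := IsAlgClosed.exists_pow_nat_eq u (n := 2) two_pos
  -- The argument divides by `2s`, so `u = 0` is separate: only the constant term survives.
  rcases eq_or_ne s 0 with rfl | hs0
  · have hu0 : u = 0 := by rw [← hs]; simp
    subst hu0
    convert! hasSum_single (f := fun a : ℕ => ((2 * a + 1 + n).choose n : ℂ) * (0 : ℂ) ^ a) 0
      (fun a ha => by simp [ha]) using 1
    simp [evenOddParts_zero, Nat.add_comm 1 n]
  have hsn : ‖s‖ < 1 := by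
    rw [← hs, norm_pow] at hu
    exact (pow_lt_one_iff_of_nonneg (norm_nonneg _) two_ne_zero).1 hu
  have h1 := (hasSum_choose_mul_geometric_of_norm_lt_one n hsn).sub
    (hasSum_choose_mul_geometric_of_norm_lt_one n (r := -s) (by rwa [norm_neg]))
  have hinj : Function.Injective fun a : ℕ => 2 * a + 1 := fun a b h => by simpa using h
  rw [← hinj.hasSum_iff] at h1
  · have h2 := h1.mul_left (2 * s)⁻¹
    have hne1 : 1 - s ≠ 0 := by
      intro h
      rw [← sub_eq_zero.1 h, norm_one] at hsn
      exact lt_irrefl _ hsn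
    have hne2 : 1 + s ≠ 0 := by
      intro h
      rw [← norm_neg, ← eq_neg_of_add_eq_zero_left h, norm_one] at hsn
      exact lt_irrefl _ hsn
    convert! h2 using 1
    · funext a
      simp only [Function.comp, ← hs, Odd.neg_pow (show Odd (2 * a + 1) from ⟨a, rfl⟩)]
      field_simp
      ring
    · have h3 := two_mul_evenOddParts_snd s (n + 1)
      rw [hs] at h3
      have h4 : (1 - u) ^ (n + 1) = (1 - s) ^ (n + 1) * (1 + s) ^ (n + 1) := by
        rw [← mul_pow, ← hs]
        ring
      rw [h4, sub_neg_eq_add]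
      field_simp
      rw [← h3]
      ring
  · intro k hk
    have hk' : Even k := by
      by_contra h
      obtain ⟨a, ha⟩ := Nat.not_even_iff_odd.1 h
      exact hk ⟨a, ha.symm⟩
    simp [hk'.neg_pow]

/-! ### The explicit kernel of the folded ball -/

theorem mem_foldedBall {m : ℕ} {z : Fin (m + 1) → ℂ} :
    z ∈ foldedBall (m + 1) ↔ ‖z 0‖ + sqNorm (Fin.tail z) < 1 := by
  have : (Finset.univ.erase 0 : Finset (Fin (m + 1))) = Finset.univ.map (Fin.succEmb m) := by
    ext i
    simp [Fin.exists_succ_eq]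
  simp [foldedBall, this, sqNorm, Fin.tail]

/-- The Bergman kernel of `foldedBall (m + 1)`. -/
noncomputable def foldedKernel (m : ℕ) (z w : Fin (m + 1) → ℂ) : ℂ :=
  (m + 1).factorial / (2 * (Real.pi : ℂ) ^ (m + 1)) *
    ((1 - hermProd (Fin.tail z) (Fin.tail w)) ^ (m + 3))⁻¹ *
    ((evenOddParts (z 0 * conj (w 0) / (1 - hermProd (Fin.tail z) (Fin.tail w)) ^ 2) (m + 2)).2 /
      (1 - z 0 * conj (w 0) / (1 - hermProd (Fin.tail z) (Fin.tail w)) ^ 2) ^ (m + 2))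

theorem conj_hermProd {m : ℕ} (z w : Fin m → ℂ) : conj (hermProd z w) = hermProd w z := by
  simp [hermProd, mul_comm]

theorem conj_foldedKernel (m : ℕ) (z w : Fin (m + 1) → ℂ) :
    conj (foldedKernel m z w) = foldedKernel m w z := by
  simp [foldedKernel, (conj_evenOddParts _ _).2, conj_hermProd, mul_comm (w 0),
    map_ofNat (starRingEnd ℂ) 2]

theorem sqNorm_tail_lt_one {m : ℕ} {z : Fin (m + 1) → ℂ} (hz : z ∈ foldedBall (m + 1)) :
    Fin.tail z ∈ euclBall m := by
  rw [mem_foldedBall] at hz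
  change sqNorm _ < 1
  linarith [norm_nonneg (z 0)]

theorem norm_div_lt_one {m : ℕ} {z : Fin (m + 1) → ℂ} (hz : z ∈ foldedBall (m + 1)) :
    ‖z 0‖ / (1 - sqNorm (Fin.tail z)) < 1 := by
  have h : 0 < 1 - sqNorm (Fin.tail z) := sub_pos.2 (sqNorm_tail_lt_one hz)
  rw [mem_foldedBall] at hz
  rw [div_lt_one h]
  linarith

/-- With `A = |z'|` and `X = |w'|`, `|w₁|(1 - A²) ≤ (1 - X²)(1 - A²) = (1 - AX)² - (A - X)²`. The
bound is below `1` and independent of `w`, which gives convergence of the series, boundedness of the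
kernel in `w`, and `u ≠ 1`. -/
theorem norm_div_sq_le {m : ℕ} {z w : Fin (m + 1) → ℂ} (hz : z ∈ foldedBall (m + 1))
    (hw : w ∈ foldedBall (m + 1)) :
    ‖z 0 * conj (w 0)‖ / ‖1 - hermProd (Fin.tail z) (Fin.tail w)‖ ^ 2 ≤
      ‖z 0‖ / (1 - sqNorm (Fin.tail z)) := by
  have hne := norm_pos_iff.2
    (one_sub_hermProd_ne_zero (sqNorm_tail_lt_one hz) (sqNorm_tail_lt_one hw))
  have h1 := one_sub_le_norm_one_sub_hermProd (Fin.tail z) (Fin.tail w)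
  have hzt : 0 < 1 - sqNorm (Fin.tail z) := sub_pos.2 (sqNorm_tail_lt_one hz)
  rw [mem_foldedBall] at hw
  have hA := Real.sq_sqrt (sqNorm_nonneg (Fin.tail z))
  have hX := Real.sq_sqrt (sqNorm_nonneg (Fin.tail w))
  have hA1 := sqrt_sqNorm_lt_one (sqNorm_tail_lt_one hz)
  have hX1 : √(sqNorm (Fin.tail w)) ≤ 1 := by
    rw [Real.sqrt_le_one]
    linarith [norm_nonneg (w 0)]
  have hA0 := Real.sqrt_nonneg (sqNorm (Fin.tail z))
  have hX0 := Real.sqrt_nonneg (sqNorm (Fin.tail w))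
  rw [norm_mul, RCLike.norm_conj, div_le_div_iff₀ (by positivity) hzt, mul_assoc]
  refine mul_le_mul_of_nonneg_left ?_ (norm_nonneg _)
  rw [← hA]
  rw [← hX] at hw
  rw [← hA] at hzt
  set A := √(sqNorm (Fin.tail z))
  set X := √(sqNorm (Fin.tail w))
  have hAX : 0 ≤ 1 - A * X := by nlinarith
  calc ‖w 0‖ * (1 - A ^ 2) ≤ (1 - X ^ 2) * (1 - A ^ 2) :=
        mul_le_mul_of_nonneg_right (by linarith) hzt.le
    _ ≤ (1 - A * X) ^ 2 := by nlinarith [sq_nonneg (A - X)]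
    _ ≤ _ := pow_le_pow_left₀ hAX h1 2

/-- The terms of a series majorizing `foldedKernel m z`. -/
noncomputable def foldedBound (m : ℕ) (z : Fin (m + 1) → ℂ) (a : ℕ) : ℝ :=
  ‖((m + 1).factorial / (2 * (Real.pi : ℂ) ^ (m + 1)) *
      ((2 * a + 1 + (m + 1)).choose (m + 1) : ℂ))‖ *
    (‖z 0‖ / (1 - sqNorm (Fin.tail z))) ^ a * ((1 - √(sqNorm (Fin.tail z))) ^ (m + 3))⁻¹

theorem summable_foldedBound {m : ℕ} {z : Fin (m + 1) → ℂ} (hz : z ∈ foldedBall (m + 1)) :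
    Summable (foldedBound m z) := by
  refine Summable.mul_right _ ?_
  set ρ := ‖z 0‖ / (1 - sqNorm (Fin.tail z)) with hρ
  have hρ0 : 0 ≤ ρ := div_nonneg (norm_nonneg _) (sub_pos.2 (sqNorm_tail_lt_one hz)).le
  have hn : ‖(ρ : ℂ)‖ = ρ := by rw [Complex.norm_real, Real.norm_of_nonneg hρ0]
  have h1 := (hasSum_choose_odd_mul_pow (m + 1) (u := ρ)
    (by rw [hn]; exact norm_div_lt_one hz)).summable.norm.mul_left
      ‖((m + 1).factorial / (2 * (Real.pi : ℂ) ^ (m + 1)))‖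
  refine h1.congr fun a => ?_
  rw [norm_mul, norm_pow, hn, norm_mul, mul_assoc]

theorem norm_foldedKernel_term_le {m : ℕ} {z w : Fin (m + 1) → ℂ} (hz : z ∈ foldedBall (m + 1))
    (hw : w ∈ foldedBall (m + 1)) (a : ℕ) :
    ‖conj (w 0) ^ a * (((m + 1).factorial / (2 * (Real.pi : ℂ) ^ (m + 1)) *
      ((2 * a + 1 + (m + 1)).choose (m + 1) : ℂ)) * z 0 ^ a *
      ((1 - hermProd (Fin.tail z) (Fin.tail w)) ^ (m + 1 + 2 * (a + 1)))⁻¹)‖ ≤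
    foldedBound m z a := by
  have h1 := one_sub_sqrt_le_norm_one_sub_hermProd (z := Fin.tail z) (sqNorm_tail_lt_one hw)
  have h2 := norm_div_sq_le hz hw
  have h3 : 0 < 1 - √(sqNorm (Fin.tail z)) := sub_pos.2 (sqrt_sqNorm_lt_one (sqNorm_tail_lt_one hz))
  have h4 : 0 < 1 - sqNorm (Fin.tail z) := sub_pos.2 (sqNorm_tail_lt_one hz)
  rw [show m + 1 + 2 * (a + 1) = (m + 3) + 2 * a by ring, norm_conj_pow_mul_inv]
  unfold foldedBound
  gcongr

theorem hasSum_foldedKernel {m : ℕ} {z w : Fin (m + 1) → ℂ} (hz : z ∈ foldedBall (m + 1))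
    (hw : w ∈ foldedBall (m + 1)) :
    HasSum (fun a : ℕ => conj (w 0) ^ a * (((m + 1).factorial / (2 * (Real.pi : ℂ) ^ (m + 1)) *
      ((2 * a + 1 + (m + 1)).choose (m + 1) : ℂ)) * z 0 ^ a *
      ((1 - hermProd (Fin.tail z) (Fin.tail w)) ^ (m + 1 + 2 * (a + 1)))⁻¹))
      (foldedKernel m z w) := by
  have hu : ‖z 0 * conj (w 0) / (1 - hermProd (Fin.tail z) (Fin.tail w)) ^ 2‖ < 1 := by
    rw [norm_div, norm_pow]
    exact (norm_div_sq_le hz hw).trans_lt (norm_div_lt_one hz)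
  convert! (hasSum_choose_odd_mul_pow (m + 1) hu).mul_left
    ((m + 1).factorial / (2 * (Real.pi : ℂ) ^ (m + 1)) *
    ((1 - hermProd (Fin.tail z) (Fin.tail w)) ^ (m + 3))⁻¹) using 1
  funext a
  rw [show m + 1 + 2 * (a + 1) = (m + 3) + 2 * a by ring, pow_add _ (m + 3), pow_mul _ 2 a, div_pow,
    mul_pow]
  simp only [div_eq_mul_inv, mul_inv]
  ring

theorem isOpen_foldedBall (m : ℕ) : IsOpen (foldedBall (m + 1)) := by
  refine isOpen_lt ?_ continuous_const
  fun_prop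

theorem convex_foldedBall (m : ℕ) : Convex ℝ (foldedBall (m + 1)) := by
  have h1 : ∀ i, ConvexOn ℝ Set.univ fun z : Fin (m + 1) → ℂ => ‖z i‖ := fun i =>
    (convexOn_univ_norm (E := ℂ)).comp_linearMap
      (LinearMap.proj i : (Fin (m + 1) → ℂ) →ₗ[ℝ] ℂ)
  have h2 : ∀ i, ConvexOn ℝ Set.univ fun z : Fin (m + 1) → ℂ => ‖z i‖ ^ 2 := fun i =>
    (h1 i).pow (fun _ _ => norm_nonneg _) 2
  intro x hx y hy a b ha hb hab
  have key : ∀ g : (Fin (m + 1) → ℂ) → ℝ, ConvexOn ℝ Set.univ g →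
      g (a • x + b • y) ≤ a * g x + b * g y := fun g hg =>
    hg.2 (Set.mem_univ x) (Set.mem_univ y) ha hb hab
  have h3 := key _ (h1 0)
  have h4 := Finset.sum_le_sum fun i (_ : i ∈ Finset.univ.erase (0 : Fin (m + 1))) => key _ (h2 i)
  rw [Finset.sum_add_distrib, ← Finset.mul_sum, ← Finset.mul_sum] at h4
  change _ < (1 : ℝ) at hx hy ⊢
  have h5 : a * (‖x 0‖ + ∑ i ∈ Finset.univ.erase 0, ‖x i‖ ^ 2) +
      b * (‖y 0‖ + ∑ i ∈ Finset.univ.erase 0, ‖y i‖ ^ 2) < 1 := by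
    -- Strictness needs a positive weight on one of the two points.
    rcases ha.eq_or_lt with rfl | ha'
    · have : b = 1 := by linarith
      subst this
      linarith
    · nlinarith
  linarith

theorem volume_foldedBall_lt_top (m : ℕ) : volume (foldedBall (m + 1)) < ⊤ := by
  refine (measure_mono (t := Metric.closedBall 0 1) fun z hz => ?_).trans_lt
    measure_closedBall_lt_top
  have hz' := mem_foldedBall.1 hz
  rw [mem_closedBall_zero_iff, pi_norm_le_iff_of_nonneg zero_le_one]
  intro i
  refine Fin.cases ?_ (fun j => ?_) i
  · linarith [sqNorm_nonneg (Fin.tail z)]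
  · have h1 : ‖z j.succ‖ ^ 2 ≤ sqNorm (Fin.tail z) :=
      Finset.single_le_sum (f := fun j => ‖Fin.tail z j‖ ^ 2) (fun _ _ => by positivity)
        (Finset.mem_univ j)
    nlinarith [norm_nonneg (z 0), norm_nonneg (z j.succ)]

theorem setOf_finCons_mem_foldedBall (m : ℕ) :
    {p : ℂ × (Fin m → ℂ) | (Fin.cons p.1 p.2 : Fin (m + 1) → ℂ) ∈ foldedBall (m + 1)} =
      hartogsSet (euclBall m) fun x => 1 - sqNorm x := by
  ext p
  simp only [Set.mem_ofPred_eq, mem_foldedBall, Fin.cons_zero, Fin.tail_cons, hartogsSet, euclBall]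
  constructor
  · intro h
    exact ⟨by linarith [norm_nonneg p.1], by linarith⟩
  · rintro ⟨-, h⟩
    linarith

/-- The Hartogs transfer with `s = 0` and `R = 1 - |x|²`. Here `R` is not a square root, so the base
weight has exponent `2(a+1)`, which is why only the binomials with odd `2a + 1` occur. -/
theorem foldedKernel_reproducing {m : ℕ} {f : (Fin (m + 1) → ℂ) → ℂ}
    (hf : DifferentiableOn ℂ f (foldedBall (m + 1))) (hi : IntegrableOn f (foldedBall (m + 1)))
    {z : Fin (m + 1) → ℂ} (hz : z ∈ foldedBall (m + 1)) :
    f z = ∫ w in foldedBall (m + 1), f w * foldedKernel m z w := by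
  have hset := setOf_finCons_mem_foldedBall m
  have hcons : (Fin.cons (z 0) (Fin.tail z) : Fin (m + 1) → ℂ) = z := Fin.cons_self_tail z
  have hmem : ∀ q ∈ hartogsSet (euclBall m) (fun x => 1 - sqNorm x),
      (Fin.cons q.1 q.2 : Fin (m + 1) → ℂ) ∈ foldedBall (m + 1) := by
    intro q hq
    rwa [← hset] at hq
  have hzH : (z 0, Fin.tail z) ∈ hartogsSet (euclBall m) fun x => 1 - sqNorm x := by
    rw [← hset]
    simpa only [Set.mem_ofPred_eq, hcons] using hz
  have hR : Continuous fun x : Fin m → ℂ => 1 - sqNorm x :=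
    continuous_const.sub continuous_sqNorm
  have hmain := (ballReproducing m).setIntegral_hartogsSet hR (fun x hx => sub_pos.2 hx)
    (fun x _ => by linarith [sqNorm_nonneg x]) 0 (fun a => 2 * (a + 1)) (fun x _ a => rfl)
    (f := fun p => f (Fin.cons p.1 p.2))
    (hf.comp differentiable_uncurry_finCons.differentiableOn hmem)
    (by
      rw [← integrableOn_finCons, hset] at hi
      simpa only [pow_zero, Complex.ofReal_one, mul_one] using hi)
    hzH (κ := fun a => (m + 1).factorial / (2 * (Real.pi : ℂ) ^ (m + 1)) *
      ((2 * a + 1 + (m + 1)).choose (m + 1) : ℂ)) (c := 1)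
    -- Since `betaConst a 0 = 1/(a+1)` and `(2(a+1))! = 2(a+1)(2a+1)!`, a factor `2` remains; it is
    -- the `2` in the denominator of the kernel's constant.
    (fun a => by
      have h1 : ((2 * a + 1 + (m + 1)).choose (m + 1) : ℂ) * ((2 * a + 1).factorial *
          (m + 1).factorial) = (m + 2 * (a + 1)).factorial := by
        rw [show m + 2 * (a + 1) = 2 * a + 1 + (m + 1) by ring,
          ← Nat.add_choose_mul_factorial_mul_factorial (2 * a + 1) (m + 1)]
        push_cast
        ring
      have h2 : ((a.factorial : ℕ) : ℂ) ≠ 0 := by exact_mod_cast Nat.factorial_ne_zero _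
      have h3 : ((m + 2 * (a + 1)).factorial : ℂ) ≠ 0 := by
        exact_mod_cast Nat.factorial_ne_zero _
      have h4 : (a + 1 : ℂ) ≠ 0 := by exact_mod_cast Nat.succ_ne_zero a
      have h5 : (Real.pi : ℂ) ≠ 0 := by exact_mod_cast Real.pi_ne_zero
      have h6 : ((2 * (a + 1)).factorial : ℂ) = 2 * (a + 1) * (2 * a + 1).factorial := by
        rw [show 2 * (a + 1) = 2 * a + 1 + 1 by ring, Nat.factorial_succ]
        push_cast
        ring
      simp only [betaConst, add_zero, Nat.factorial_succ a, h6]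
      push_cast
      field_simp
      rw [← h1]
      ring)
    (k := fun q => foldedKernel m z (Fin.cons q.1 q.2))
    (fun q hq => by
      simpa only [Fin.cons_zero, Fin.tail_cons] using hasSum_foldedKernel hz (hmem q hq))
    (summable_foldedBound hz)
    (fun a q hq => by
      simpa only [Fin.cons_zero, Fin.tail_cons] using norm_foldedKernel_term_le hz (hmem q hq) a)
  simp only [hcons, one_mul, pow_zero, Complex.ofReal_one, mul_one] at hmain
  rw [← hmain, setIntegral_finCons, hset]

theorem one_sub_div_ne_zero {m : ℕ} {z w : Fin (m + 1) → ℂ} (hz : z ∈ foldedBall (m + 1))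
    (hw : w ∈ foldedBall (m + 1)) :
    1 - z 0 * conj (w 0) / (1 - hermProd (Fin.tail z) (Fin.tail w)) ^ 2 ≠ 0 := by
  have h := (norm_div_sq_le hz hw).trans_lt (norm_div_lt_one hz)
  rw [← norm_pow, ← norm_div] at h
  intro h0
  rw [← sub_eq_zero.1 h0, norm_one] at h
  exact lt_irrefl _ h

theorem differentiableOn_foldedKernel {m : ℕ} {z : Fin (m + 1) → ℂ} (hz : z ∈ foldedBall (m + 1)) :
    DifferentiableOn ℂ (fun w => foldedKernel m w z) (foldedBall (m + 1)) := by
  intro w hw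
  refine DifferentiableAt.differentiableWithinAt ?_
  have h1 := one_sub_hermProd_ne_zero (sqNorm_tail_lt_one hw) (sqNorm_tail_lt_one hz)
  have h2 := one_sub_div_ne_zero hw hz
  have hd : Differentiable ℂ fun w : Fin (m + 1) → ℂ =>
      1 - hermProd (Fin.tail w) (Fin.tail z) := by
    simp only [hermProd, Fin.tail]
    fun_prop
  have hu : DifferentiableAt ℂ (fun w : Fin (m + 1) → ℂ =>
      w 0 * conj (z 0) / (1 - hermProd (Fin.tail w) (Fin.tail z)) ^ 2) w := by
    simp only [div_eq_mul_inv]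
    exact DifferentiableAt.fun_mul (by fun_prop) (((hd w).fun_pow 2).fun_inv (pow_ne_zero 2 h1))
  unfold foldedKernel
  simp only [div_eq_mul_inv _ ((1 - _ : ℂ) ^ (m + 2))]
  refine DifferentiableAt.fun_mul (DifferentiableAt.fun_mul (differentiableAt_const _)
    (((hd w).fun_pow _).fun_inv (pow_ne_zero _ h1))) (DifferentiableAt.fun_mul ?_ ?_)
  · exact ((differentiable_evenOddParts (m + 2)).2 _).comp w hu
  · exact (((differentiableAt_const _).fun_sub hu).fun_pow _).fun_inv (pow_ne_zero _ h2)

/-! ### Existence and uniqueness of the Bergman kernel -/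

theorem isBergmanKernel_foldedKernel (m : ℕ) :
    IsBergmanKernel (foldedBall (m + 1)) (foldedKernel m) where
  mem z hz := by
    have hfin : IsFiniteMeasure (volume.restrict (foldedBall (m + 1))) :=
      ⟨by simpa using volume_foldedBall_lt_top m⟩
    have hd : DifferentiableOn ℂ (fun w => conj (foldedKernel m z w)) (foldedBall (m + 1)) := by
      simp only [conj_foldedKernel]
      exact differentiableOn_foldedKernel hz
    -- The majorant series bounds the kernel in `w`, and a bounded function on a set of finite
    -- volume is square-integrable.
    have hm := (isOpen_foldedBall m).measurableSet
    refine ⟨hd, MemLp.of_bound (hd.continuousOn.aestronglyMeasurable hm) (∑' a, foldedBound m z a)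
      ((ae_restrict_iff' hm).2 (ae_of_all _ fun w hw => ?_))⟩
    rw [RCLike.norm_conj, ← (hasSum_foldedKernel hz hw).tsum_eq]
    exact tsum_of_norm_bounded (summable_foldedBound hz).hasSum (norm_foldedKernel_term_le hz hw)
  reproducing f hf z hz := by
    have hfin : IsFiniteMeasure (volume.restrict (foldedBall (m + 1))) :=
      ⟨by simpa using volume_foldedBall_lt_top m⟩
    exact foldedKernel_reproducing hf.holo (hf.memLp.integrable one_le_two) hz

/-- Reproducing `h = conj (K z ·) - conj (K' z ·)` with both kernels and subtracting gives `∫ |h|² =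
0`; continuity turns vanishing almost everywhere into vanishing on `Ω`. -/
theorem IsBergmanKernel.eq_of_mem {n : ℕ} {Ω : Set (Fin n → ℂ)} (hΩ : IsOpen Ω)
    {K K' : (Fin n → ℂ) → (Fin n → ℂ) → ℂ} (hK : IsBergmanKernel Ω K) (hK' : IsBergmanKernel Ω K')
    {z w : Fin n → ℂ} (hz : z ∈ Ω) (hw : w ∈ Ω) : K z w = K' z w := by
  set h : (Fin n → ℂ) → ℂ := fun w => conj (K z w) - conj (K' z w) with hh
  have hmem : MemBergman Ω h :=
    ⟨(hK.mem z hz).holo.sub (hK'.mem z hz).holo, (hK.mem z hz).memLp.sub (hK'.mem z hz).memLp⟩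
  have hint : ∀ L, IsBergmanKernel Ω L → IntegrableOn (fun w => h w * L z w) Ω := by
    intro L hL
    have h1 : MemLp (fun w => L z w) 2 (volume.restrict Ω) := by
      have h2 := (hL.mem z hz).memLp.star
      simpa [Pi.star_def] using h2
    exact hmem.memLp.integrable_mul h1
  have h1 : ∫ w in Ω, (h w * K z w - h w * K' z w) = 0 := by
    rw [integral_sub (hint K hK) (hint K' hK'), ← hK.reproducing h hmem z hz,
      ← hK'.reproducing h hmem z hz, sub_self]
  have h2 : ∀ w, h w * K z w - h w * K' z w = ((‖h w‖ ^ 2 : ℝ) : ℂ) := by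
    intro w
    rw [← Complex.normSq_eq_norm_sq, ← Complex.mul_conj, hh]
    simp
    ring
  simp_rw [h2] at h1
  rw [integral_complex_ofReal, Complex.ofReal_eq_zero,
    integral_eq_zero_iff_of_nonneg (fun _ => by positivity) hmem.memLp.norm.integrable_sq] at h1
  have h3 : h =ᵐ[volume.restrict Ω] 0 := by
    filter_upwards [h1] with w hw
    simpa using hw
  have h4 := Measure.eqOn_open_of_ae_eq h3 hΩ hmem.holo.continuousOn continuousOn_const hw
  have h5 : conj (K z w) = conj (K' z w) := sub_eq_zero.1 h4
  exact (starRingEnd ℂ).injective h5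

/-! ### Zeros of the kernel -/

/-- Take `s = i tan θ`. Then `(1 ± s) cos θ = e^(±iθ)`, whose `N`-th powers are both `-1`, so
`(1+s)^N = (1-s)^N`. -/
theorem evenOddParts_snd_eq_zero {N : ℕ} {θ : ℝ} (hθ : N * θ = Real.pi) (hcos : Real.cos θ ≠ 0)
    (hsin : Real.sin θ ≠ 0) : (evenOddParts (-((Real.tan θ : ℝ) : ℂ) ^ 2) N).2 = 0 := by
  have hc : (Real.cos θ : ℂ) ≠ 0 := by exact_mod_cast hcos
  have ht : (Real.tan θ : ℂ) ≠ 0 := by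
    rw [Real.tan_eq_sin_div_cos]
    exact_mod_cast div_ne_zero hsin hcos
  have hmul : (Real.tan θ : ℂ) * Real.cos θ = Real.sin θ := by
    exact_mod_cast Real.tan_mul_cos hcos
  have hp : (N : ℂ) * (θ : ℂ) = Real.pi := by exact_mod_cast hθ
  have h1 : ((1 + Complex.I * Real.tan θ) * Real.cos θ) ^ N = -1 := by
    have := Complex.cos_add_sin_mul_I_pow N θ
    rw [hp, Complex.cos_pi, Complex.sin_pi, zero_mul, add_zero] at this
    rw [← this, ← Complex.ofReal_cos, ← Complex.ofReal_sin, ← hmul]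
    ring
  have h2 : ((1 - Complex.I * Real.tan θ) * Real.cos θ) ^ N = -1 := by
    have := Complex.cos_add_sin_mul_I_pow N (-θ)
    rw [mul_neg, hp, Complex.cos_neg, Complex.cos_neg, Complex.cos_pi, Complex.sin_neg,
      Complex.sin_neg, Complex.sin_pi, neg_zero, zero_mul, add_zero] at this
    rw [← this, ← Complex.ofReal_cos, ← Complex.ofReal_sin, ← hmul]
    ring
  have h3 := two_mul_evenOddParts_snd (Complex.I * Real.tan θ) N
  rw [mul_pow] at h1 h2
  rw [mul_right_cancel₀ (pow_ne_zero N hc) (h1.trans h2.symm), sub_self, mul_pow, Complex.I_sq,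
    neg_one_mul] at h3
  exact (mul_eq_zero.1 h3).resolve_left
    (mul_ne_zero two_ne_zero (mul_ne_zero Complex.I_ne_zero ht))

theorem exists_foldedKernel_eq_zero {m : ℕ} (hm : 4 ≤ m + 1) :
    ∃ z ∈ foldedBall (m + 1), ∃ w ∈ foldedBall (m + 1), foldedKernel m z w = 0 := by
  have hm' : (3 : ℝ) ≤ m := by exact_mod_cast (by omega : 3 ≤ m)
  set θ : ℝ := Real.pi / (m + 2) with hθ
  have hpi := Real.pi_pos
  have hθ0 : 0 < θ := by positivity
  have hθ1 : θ < Real.pi / 4 := div_lt_div_of_pos_left hpi (by norm_num) (by linarith)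
  have hcos : 0 < Real.cos θ := Real.cos_pos_of_mem_Ioo ⟨by linarith, by linarith⟩
  have hsin : 0 < Real.sin θ := Real.sin_pos_of_pos_of_lt_pi hθ0 (by linarith)
  have ht0 : 0 < Real.tan θ := Real.tan_pos_of_pos_of_lt_pi_div_two hθ0 (by linarith)
  have ht1 : Real.tan θ < 1 := by
    rw [← Real.tan_pi_div_four]
    exact Real.tan_lt_tan_of_lt_of_lt_pi_div_two (by linarith) (by linarith) hθ1
  have hmem : ∀ t : ℝ, |t| < 1 → (Fin.cons (t : ℂ) 0 : Fin (m + 1) → ℂ) ∈ foldedBall (m + 1) := by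
    intro t ht
    rw [mem_foldedBall]
    simpa [sqNorm] using ht
  -- The points `(t, 0)` and `(-t, 0)` give `u = -t²`; with `t = tan(π/(m+2))` they lie in the
  -- domain since `m + 2 > 4` forces `t < 1`.
  refine ⟨_, hmem (Real.tan θ) (by rwa [abs_of_pos ht0]), _,
    hmem (-Real.tan θ) (by rwa [abs_neg, abs_of_pos ht0]), ?_⟩
  have hu : ((Real.tan θ : ℝ) : ℂ) * conj ((-Real.tan θ : ℝ) : ℂ) =
      -((Real.tan θ : ℝ) : ℂ) ^ 2 := by
    rw [Complex.conj_ofReal]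
    push_cast
    ring
  have h0 : hermProd (0 : Fin m → ℂ) 0 = 0 := by simp [hermProd]
  unfold foldedKernel
  rw [Fin.cons_zero, Fin.cons_zero, Fin.tail_cons, Fin.tail_cons, h0, sub_zero, one_pow 2, div_one,
    hu, evenOddParts_snd_eq_zero (by rw [hθ]; push_cast; field_simp) hcos.ne' hsin.ne', zero_div,
    mul_zero]

theorem evenOddParts_snd_ne_zero {u : ℂ} (hu : ‖u‖ < 1) {m : ℕ} (hm : m < 3) :
    (evenOddParts u (m + 2)).2 ≠ 0 := by
  -- For `m = 0, 1, 2` the odd part is `2`, `3 + u`, `4(1 + u)`; the case `c = 1` is the borderline,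
  -- with its zero on the unit circle.
  have key : ∀ c : ℝ, 1 ≤ c → (c : ℂ) + u ≠ 0 := by
    intro c hc h
    rw [← neg_eq_iff_add_eq_zero.2 h, norm_neg, Complex.norm_real, Real.norm_of_nonneg
      (by linarith)] at hu
    linarith
  interval_cases m
  · simp only [evenOddParts]
    norm_num
  · have h := key 3 (by norm_num)
    intro h0
    simp only [evenOddParts] at h0
    refine h ?_
    rw [← h0]
    push_cast
    ring
  · have h := key 1 le_rfl
    intro h0
    simp only [evenOddParts] at h0
    refine mul_ne_zero (by norm_num : (4 : ℂ) ≠ 0) h ?_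
    rw [← h0]
    push_cast
    ring

theorem foldedKernel_ne_zero {m : ℕ} (hm : m < 3) {z w : Fin (m + 1) → ℂ}
    (hz : z ∈ foldedBall (m + 1)) (hw : w ∈ foldedBall (m + 1)) : foldedKernel m z w ≠ 0 := by
  have h1 := one_sub_hermProd_ne_zero (sqNorm_tail_lt_one hz) (sqNorm_tail_lt_one hw)
  have h := (norm_div_sq_le hz hw).trans_lt (norm_div_lt_one hz)
  rw [← norm_pow, ← norm_div] at h
  have h5 : (Real.pi : ℂ) ≠ 0 := by exact_mod_cast Real.pi_ne_zero
  have h6 : ((m + 1).factorial : ℂ) ≠ 0 := by exact_mod_cast Nat.factorial_ne_zero _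
  exact mul_ne_zero (mul_ne_zero (div_ne_zero h6 (mul_ne_zero two_ne_zero (pow_ne_zero _ h5)))
    (inv_ne_zero (pow_ne_zero _ h1))) (div_ne_zero (evenOddParts_snd_ne_zero h hm)
    (pow_ne_zero _ (one_sub_div_ne_zero hz hw)))

theorem mainTheorem7 (n : ℕ) [NeZero n] :
    IsOpen (foldedBall n) ∧ Convex ℝ (foldedBall n) ∧
    (∃ K, IsBergmanKernel (foldedBall n) K) ∧
    ∀ K, IsBergmanKernel (foldedBall n) K →
      ((∃ z ∈ foldedBall n, ∃ w ∈ foldedBall n, K z w = 0) ↔ 4 ≤ n) := by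
  obtain ⟨m, rfl⟩ := Nat.exists_eq_succ_of_ne_zero (NeZero.ne n)
  refine ⟨isOpen_foldedBall m, convex_foldedBall m, ⟨_, isBergmanKernel_foldedKernel m⟩,
    fun K hK => ⟨?_, fun hm => ?_⟩⟩
  · rintro ⟨z, hz, w, hw, h0⟩
    by_contra hm
    rw [hK.eq_of_mem (isOpen_foldedBall m) (isBergmanKernel_foldedKernel m) hz hw] at h0
    exact foldedKernel_ne_zero (by omega) hz hw h0
  · obtain ⟨z, hz, w, hw, h0⟩ := exists_foldedKernel_eq_zero hm
    refine ⟨z, hz, w, hw, ?_⟩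
    rwa [hK.eq_of_mem (isOpen_foldedBall m) (isBergmanKernel_foldedKernel m) hz hw]
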